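/- Let $M$ be a finite matroid with rank function $r$. For a rooted tree $T$ (a finite tree with a distinguished vertex, its root), let $\|T\|$ be the number of edges of $T$; a leaf of $T$ is a vertex without children (so the root is a leaf exactly when $T$ has a single vertex), and the depth of $T$ is the length, in edges, of a longest path from the root to a leaf. A depth-decomposition of $M$ is a pair $(T,f)$, where $T$ is a rooted tree and $f$ is a map from the set of elements of $M$ to the vertex set $V(T)$, such that $r(M)=\|T\|$ and $r(X)\le\|T^*(X)\|$ for every set $X$ of elements of $M$, where $T^*(X)$ is the union of the paths in $T$ from the root to all the vertices in $f(X)$. The branch-depth $\mathrm{bd}(M)$ of $M$ is the smallest depth of a tree $T$ over all depth-decompositions $(T,f)$ of $M$. Then there are a depth-decomposition $(T,f)$ of $M$ and a base $B$ of $M$ such that the restriction of $f$ to $B$ is a bijection between $B$ and the set of non-root vertices of $T$, $f(e)$ is a leaf of $T$ for every element $e\notin B$ of $M$, and the depth of $T$ is at most $4^{\mathrm{bd}(M)}$. -/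

import Mathlib

/-- A finite rooted tree: a finite tree (as a graph) with a distinguished vertex, the root. -/
structure FinRootedTree where
  /-- The vertices of the tree. -/
  V : Type
  finite : Finite V
  /-- The underlying graph. -/
  graph : SimpleGraph V
  isTree : graph.IsTree
  /-- The root. -/
  root : V

namespace FinRootedTree

/-- `u` is a child of `v`: they are adjacent and `u` is one step farther from the root. -/
def IsChild (T : FinRootedTree) (u v : T.V) : Prop :=
  T.graph.Adj v u ∧ T.graph.dist T.root u = T.graph.dist T.root v + 1

/-- A leaf of a rooted tree is a vertex without children. In particular the root is a leaf
exactly if the tree has a single vertex. -/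
def IsLeaf (T : FinRootedTree) (v : T.V) : Prop :=
  ∀ u, ¬ T.IsChild u v

/-- The depth of a rooted tree: the length of a longest path from the root to a leaf. -/
noncomputable def depth (T : FinRootedTree) : ℕ :=
  sSup {n | ∃ v, T.IsLeaf v ∧ ∃ p : T.graph.Walk T.root v, p.IsPath ∧ p.length = n}

/-- The edges of the union of the paths from the root to all the vertices in `S`. -/
def rootPathsEdges (T : FinRootedTree) (S : Set T.V) : Set (Sym2 T.V) :=
  {a | ∃ v ∈ S, ∃ p : T.graph.Walk T.root v, p.IsPath ∧ a ∈ p.edges}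

end FinRootedTree

/-- A depth-decomposition of a matroid `M`. Only the values of `f` on the ground set `M.E`
matter. -/
structure DepthDecomposition {α : Type*} (M : Matroid α) where
  /-- The tree of the decomposition. -/
  tree : FinRootedTree
  /-- The map from the elements of `M` to the vertices of the tree. -/
  f : α → tree.V
  rank_eq : M.eRank = tree.graph.edgeSet.encard
  rank_le : ∀ X ⊆ M.E, M.eRk X ≤ (tree.rootPathsEdges (f '' X)).encard

/-- The branch-depth of `M`: the smallest depth of the tree of a depth-decomposition of `M`. -/
noncomputable def branchDepth {α : Type*} (M : Matroid α) : ℕ :=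
  sInf {d | ∃ D : DepthDecomposition M, D.tree.depth = d}

/-!
Bounded branch-depth means bounded circuit length. Identify a vertex of a rooted tree with the word
of edges on its root path. In a depth-decomposition of depth `d`, the number of elements minus the
number of edges of the trie of their words is nonpositive on independent sets, while it is positive
on a base plus one element. A set minimal with positive excess contains the fundamental circuit, and
it has at most `2 ^ d` elements: going down one edge of the trie increases the excess by one, hence
at most doubles it as long as it is positive.

Conversely, if no circuit has more than `c` elements, there is a decomposition of depth `c ^ 2`. If
the matroid is connected and `C` is a circuit with `c` elements, contracting `C` minus an element
shortens all circuits: a circuit of length `c` surviving the contraction could be linked to `C` by a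
circuit that runs through at least half of both and one element more, hence is longer than `c`. The
contracted elements become a path below the root, and induction gives the depth
`(c - 1) + (c - 1) ^ 2`. If the matroid is disconnected, the decompositions of its parts are glued
at their roots. For `c = 2 ^ d` the depth is `4 ^ d`.
-/

/-! ### Circuits of nonseparable matroids -/

section Circuits

open Matroid Set

variable {α : Type*} {M : Matroid α} {C D Z K I J : Set α} {e f : α}

lemma exists_isCircuit_mem_mem_of_inter_nonempty [M.Finitary] {C₁ C₂ : Set α}
    (hC₁ : M.IsCircuit C₁) (hC₂ : M.IsCircuit C₂) (he : e ∈ C₁) (hf : f ∈ C₂)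
    (hne : (C₁ ∩ C₂).Nonempty) : ∃ C, M.IsCircuit C ∧ e ∈ C ∧ f ∈ C := by
  induction hn : (C₂ \ C₁).ncard using Nat.strong_induction_on generalizing C₂ with
  | _ n ih =>
  by_contra! hcon
  have heC₂ : e ∉ C₂ := fun h ↦ hcon C₂ hC₂ h hf
  obtain ⟨a, haC₁, haC₂⟩ := hne
  obtain ⟨W, hWss, hW, heW⟩ := hC₁.strong_elimination hC₂ haC₁ haC₂ he heC₂
  obtain ⟨b, hbW, hbC₁⟩ : ∃ b ∈ W, b ∉ C₁ := by
    by_contra! h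
    exact (hWss (hC₁.eq_of_superset_isCircuit hW h ▸ haC₁)).2 rfl
  have hbC₂ : b ∈ C₂ := (hWss hbW).1.resolve_left hbC₁
  obtain ⟨U, hUss, hU, hfU⟩ := hC₂.strong_elimination hW hbC₂ hbW hf (hcon W hW heW)
  have hbU : b ∉ U := fun h ↦ (hUss h).2 rfl
  obtain ⟨y, hyU, hyC₂⟩ : ∃ y ∈ U, y ∉ C₂ := by
    by_contra! h
    exact hbU (hC₂.eq_of_superset_isCircuit hU h ▸ hbC₂)
  have hyC₁ : y ∈ C₁ := (hWss ((hUss hyU).1.resolve_left hyC₂)).1.resolve_right hyC₂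
  have hss : U \ C₁ ⊂ C₂ \ C₁ := by
    refine ⟨fun u ⟨huU, huC₁⟩ ↦ ⟨?_, huC₁⟩, fun h ↦ hbU (h ⟨hbC₂, hbC₁⟩).1⟩
    exact (hUss huU).1.elim id fun huW ↦ (hWss huW).1.resolve_left huC₁
  have hlt : (U \ C₁).ncard < n := hn ▸ ncard_lt_ncard hss hC₂.finite.sdiff
  obtain ⟨V, hV, heV, hfV⟩ := ih _ hlt hU hfU ⟨y, hyC₁, hyU⟩ rfl
  exact hcon V hV heV hfV

/-- Matroid connectivity up to loops: any two distinct nonloops lie on a common circuit. Loops are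
disregarded because contracting part of a circuit creates them. -/
def IsNonseparable (M : Matroid α) : Prop :=
  ∀ ⦃e f⦄, M.IsNonloop e → M.IsNonloop f → e ≠ f → ∃ C, M.IsCircuit C ∧ e ∈ C ∧ f ∈ C

/-- A separator of `M`: a subset of the ground set which is crossed by no circuit, so that `M` is
the direct sum of its restrictions to `K` and to the complement of `K`. -/
structure IsSeparator (M : Matroid α) (K : Set α) : Prop where
  subset_ground : K ⊆ M.E
  subset_or_subset_sdiff : ∀ ⦃C⦄, M.IsCircuit C → C ⊆ K ∨ C ⊆ M.E \ K

namespace IsSeparator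

lemma compl (hK : IsSeparator M K) : IsSeparator M (M.E \ K) where
  subset_ground := sdiff_subset
  subset_or_subset_sdiff C hC := by
    rw [sdiff_sdiff_cancel_left hK.subset_ground]
    exact (hK.subset_or_subset_sdiff hC).symm

lemma indep_union (hK : IsSeparator M K) (hI : M.Indep I) (hJ : M.Indep J) (hIK : I ⊆ K)
    (hJK : J ⊆ M.E \ K) : M.Indep (I ∪ J) := by
  rw [indep_iff_forall_subset_not_isCircuit (union_subset hI.subset_ground hJ.subset_ground)]
  intro C hCss hC
  obtain h | h := hK.subset_or_subset_sdiff hC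
  · exact hC.not_indep (hI.subset fun x hx ↦
      (hCss hx).resolve_right fun hxJ ↦ (hJK hxJ).2 (h hx))
  · exact hC.not_indep (hJ.subset fun x hx ↦
      (hCss hx).resolve_left fun hxI ↦ (h hx).2 (hIK hxI))

lemma isBase_union (hK : IsSeparator M K) (hI : M.IsBasis I K) (hJ : M.IsBasis J (M.E \ K)) :
    M.IsBase (I ∪ J) := by
  rw [← isBasis_ground_iff, ← union_sdiff_cancel hK.subset_ground]
  exact hI.union_isBasis_union hJ (hK.indep_union hI.indep hJ.indep hI.subset hJ.subset)

lemma eRk_lt_eRank [M.RankFinite] (hK : IsSeparator M K) (hf : M.IsNonloop f) (hfK : f ∉ K) :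
    M.eRk K < M.eRank := by
  obtain ⟨I, hI⟩ := M.exists_isBasis K hK.subset_ground
  have hIf : M.Indep (I ∪ {f}) :=
    hK.indep_union hI.indep hf.indep hI.subset (by simpa using ⟨hf.mem_ground, hfK⟩)
  rw [← hI.encard_eq_eRk]
  refine lt_of_lt_of_le (hI.indep.finite.encard_lt_encard ?_) hIf.encard_le_eRank
  simpa using ssubset_insert fun h ↦ hfK (hI.subset h)

end IsSeparator

lemma exists_isSeparator_of_not_isNonseparable [M.Finitary] (hM : ¬ IsNonseparable M) :
    ∃ K, IsSeparator M K ∧ (∃ e ∈ K, M.IsNonloop e) ∧ ∃ f ∉ K, M.IsNonloop f := by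
  simp only [IsNonseparable, not_forall] at hM
  obtain ⟨e, f, he, hf, hef, hcon⟩ := hM
  refine ⟨{x ∈ M.E | x = e ∨ ∃ C, M.IsCircuit C ∧ e ∈ C ∧ x ∈ C}, ⟨sep_subset .., fun C hC ↦ ?_⟩,
    ⟨e, ⟨he.mem_ground, .inl rfl⟩, he⟩, f, fun h ↦ h.2.elim hef.symm hcon, hf⟩
  rw [or_iff_not_imp_right, not_subset]
  rintro ⟨x, hxC, hx⟩ y hyC
  refine ⟨hC.subset_ground hyC, .inr ?_⟩
  obtain rfl | ⟨C', hC', heC', hxC'⟩ :=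
    (not_not.1 fun h ↦ hx ⟨hC.subset_ground hxC, h⟩ :
      x ∈ {x ∈ M.E | x = e ∨ ∃ C, M.IsCircuit C ∧ e ∈ C ∧ x ∈ C}).2
  · exact ⟨C, hC, hxC, hyC⟩
  · exact exists_isCircuit_mem_mem_of_inter_nonempty hC' hC heC' hyC ⟨x, hxC', hxC⟩

lemma exists_isCircuit_sdiff_eq_of_series (hC : M.IsCircuit C) (hZ : M.IsCircuit Z)
    (hZC : (Z ∩ C).Nonempty) (hne : (Z \ C).Nonempty)
    (hser : ∀ U, M.IsCircuit U → U ⊆ C ∪ Z → U ⊆ C ∨ Z \ C ⊆ U) :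
    ∃ W, M.IsCircuit W ∧ W \ C = Z \ C ∧ C \ Z ⊆ W := by
  obtain ⟨p, hpZ, hpC⟩ := hZC
  obtain ⟨q, hqZ, hqC⟩ := hne
  obtain ⟨W, hWss, hW, hqW⟩ := hZ.strong_elimination hC hpZ hpC hqZ hqC
  have hWCZ : W ⊆ C ∪ Z := union_comm Z C ▸ hWss.trans sdiff_subset
  have hZW : Z \ C ⊆ W := (hser W hW hWCZ).resolve_left fun h ↦ hqC (h hqW)
  have hWZ : W ≠ Z := fun h ↦ (hWss (h ▸ hpZ)).2 rfl
  obtain ⟨U, hUss, hU⟩ := hW.elimination hZ hWZ q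
  have hUC : U ⊆ C := (hser U hU fun x hx ↦ (hUss hx).1.elim (fun h ↦ hWCZ h) .inr).resolve_right
    fun h ↦ (hUss (h ⟨hqZ, hqC⟩)).2 rfl
  refine ⟨W, hW, Subset.antisymm (fun x hx ↦ ⟨(hWCZ hx.1).resolve_left hx.2, hx.2⟩)
    (fun x hx ↦ ⟨hZW hx, hx.2⟩), fun x hx ↦ ?_⟩
  rw [hC.eq_of_superset_isCircuit hU hUC] at hx
  exact (hUss hx.1).1.resolve_right hx.2

/-- A circuit linking `C` and `D` as tightly as possible: it meets both and has an
inclusionwise minimal set of elements outside `C ∪ D` among such circuits. -/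
def IsTightLink (M : Matroid α) (C D Z : Set α) : Prop :=
  MinimalFor (fun Z ↦ M.IsCircuit Z ∧ (Z ∩ C).Nonempty ∧ (Z ∩ D).Nonempty) (· \ (C ∪ D)) Z

namespace IsTightLink

lemma isCircuit (hZ : IsTightLink M C D Z) : M.IsCircuit Z := hZ.prop.1

lemma inter_left_nonempty (hZ : IsTightLink M C D Z) : (Z ∩ C).Nonempty := hZ.prop.2.1

lemma inter_right_nonempty (hZ : IsTightLink M C D Z) : (Z ∩ D).Nonempty := hZ.prop.2.2

lemma symm (hZ : IsTightLink M C D Z) : IsTightLink M D C Z := by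
  simpa only [IsTightLink, union_comm D C, and_comm (a := (_ ∩ D).Nonempty)] using hZ

lemma of_sdiff_eq {W : Set α} (hZ : IsTightLink M C D Z) (hW : M.IsCircuit W)
    (hWC : (W ∩ C).Nonempty) (hWD : (W ∩ D).Nonempty)
    (h : W \ (C ∪ D) = Z \ (C ∪ D)) : IsTightLink M C D W :=
  ⟨⟨hW, hWC, hWD⟩, fun _ hU hle ↦ h.le.trans (hZ.2 hU (hle.trans h.le))⟩

lemma sdiff_subset_of_inter_nonempty {U : Set α} (hZ : IsTightLink M C D Z) (hU : M.IsCircuit U)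
    (hUCZ : U ⊆ C ∪ Z) (hUD : (U ∩ D).Nonempty) : Z \ (C ∪ D) ⊆ U := by
  by_cases hUC : (U ∩ C).Nonempty
  · exact (hZ.2 ⟨hU, hUC, hUD⟩ fun x hx ↦
      ⟨(hUCZ hx.1).resolve_left fun h ↦ hx.2 (.inl h), hx.2⟩).trans sdiff_subset
  · have hUZ : U ⊆ Z := fun x hx ↦ (hUCZ hx).resolve_left fun h ↦ hUC ⟨x, hx, h⟩
    exact hZ.isCircuit.eq_of_superset_isCircuit hU hUZ ▸ sdiff_subset

lemma subset_or_sdiff_subset {U : Set α} (hZ : IsTightLink M C D Z)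
    (hne : (Z \ (C ∪ D)).Nonempty) (hU : M.IsCircuit U) (hUCZ : U ⊆ C ∪ Z) :
    U ⊆ C ∨ Z \ C ⊆ U := by
  have avoid : ∀ {y x}, y ∈ Z → y ∈ U → x ∈ Z → x ∉ U → x ∈ D → y ∉ Z \ (C ∪ D) := by
    intro y x hyZ hyU hxZ hxU hxD hy
    obtain ⟨V, hVss, hV, hxV⟩ := hZ.isCircuit.strong_elimination hU hyZ hyU hxZ hxU
    have hVCZ : V ⊆ C ∪ Z := fun v hv ↦ (hVss hv).1.elim .inr fun h ↦ hUCZ h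
    exact (hVss (hZ.sdiff_subset_of_inter_nonempty hV hVCZ ⟨x, hxV, hxD⟩ hy)).2 rfl
  by_contra! h
  obtain ⟨⟨y, hyU, hyC⟩, x, ⟨hxZ, hxC⟩, hxU⟩ := h.imp not_subset.1 not_subset.1
  have hyZ : y ∈ Z := (hUCZ hyU).resolve_left hyC
  by_cases hUD : (U ∩ D).Nonempty
  · have hOU := hZ.sdiff_subset_of_inter_nonempty hU hUCZ hUD
    have hxD : x ∈ D := by
      by_contra hxD
      exact hxU (hOU ⟨hxZ, not_or.2 ⟨hxC, hxD⟩⟩)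
    obtain ⟨o, ho⟩ := hne
    exact avoid ho.1 (hOU ho) hxZ hxU hxD ho
  · obtain ⟨q, hqZ, hqD⟩ := hZ.inter_right_nonempty
    exact avoid hyZ hyU hqZ (fun hqU ↦ hUD ⟨q, hqU, hqD⟩) hqD
      ⟨hyZ, not_or.2 ⟨hyC, fun hyD ↦ hUD ⟨y, hyU, hyD⟩⟩⟩

lemma exists_sdiff_eq_and_ncard_le [M.Finitary] (hZ : IsTightLink M C D Z) (hC : M.IsCircuit C)
    (hdj : Disjoint C D) (hne : (Z \ (C ∪ D)).Nonempty) :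
    ∃ W, IsTightLink M C D W ∧ W \ C = Z \ C ∧ C.ncard ≤ 2 * (W ∩ C).ncard := by
  by_cases hle : C.ncard ≤ 2 * (Z ∩ C).ncard
  · exact ⟨Z, hZ, rfl, hle⟩
  obtain ⟨W, hW, hWZ, hCW⟩ := exists_isCircuit_sdiff_eq_of_series hC hZ.isCircuit
    hZ.inter_left_nonempty (hne.mono (sdiff_subset_sdiff_right subset_union_left))
    fun _ hU hUCZ ↦ hZ.subset_or_sdiff_subset hne hU hUCZ
  have hcard : (Z ∩ C).ncard + (C \ Z).ncard = C.ncard :=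
    inter_comm Z C ▸ ncard_inter_add_ncard_sdiff_eq_ncard C Z hC.finite
  have hle' : (C \ Z).ncard ≤ (W ∩ C).ncard :=
    ncard_le_ncard (fun x hx ↦ ⟨hCW hx, hx.1⟩) (hC.finite.subset inter_subset_right)
  have hWC : (W ∩ C).Nonempty := nonempty_of_ncard_ne_zero (by omega)
  have hWD : (W ∩ D).Nonempty := by
    obtain ⟨q, hqZ, hqD⟩ := hZ.inter_right_nonempty
    have hqW : q ∈ W \ C := hWZ ▸ ⟨hqZ, hdj.notMem_of_mem_right hqD⟩
    exact ⟨q, hqW.1, hqD⟩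
  exact ⟨W, hZ.of_sdiff_eq hW hWC hWD (by rw [← sdiff_sdiff, hWZ, sdiff_sdiff]), hWZ, by omega⟩

end IsTightLink

lemma exists_isTightLink_of_inter_nonempty [M.Finitary] (hZ : M.IsCircuit Z)
    (hZC : (Z ∩ C).Nonempty) (hZD : (Z ∩ D).Nonempty) : ∃ Z, IsTightLink M C D Z := by
  obtain ⟨Z', hZ', hmin⟩ := exists_minimalFor_of_wellFoundedLT
    (fun Z ↦ M.IsCircuit Z ∧ (Z ∩ C).Nonempty ∧ (Z ∩ D).Nonempty)
    (fun Z ↦ (Z \ (C ∪ D)).ncard) ⟨Z, hZ, hZC, hZD⟩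
  have hfin : (Z' \ (C ∪ D)).Finite := hZ'.1.finite.sdiff
  exact ⟨Z', hZ', fun W hW hss ↦
    (eq_of_subset_of_ncard_le hss (hmin hW (ncard_le_ncard hss hfin)) hfin).ge⟩

namespace IsNonseparable

lemma exists_isTightLink [M.Finitary] (hM : IsNonseparable M) (hC : M.IsCircuit C)
    (hD : M.IsCircuit D) (hC₁ : 1 < C.ncard) (hD₁ : 1 < D.ncard) (hdj : Disjoint C D) :
    ∃ Z, IsTightLink M C D Z := by
  have hnl : ∀ {C}, M.IsCircuit C → 1 < C.ncard → ∃ e ∈ C, M.IsNonloop e := fun {C} hC hC₁ ↦ by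
    obtain ⟨e, he⟩ := hC.nonempty
    exact ⟨e, he, hC.isNonloop_of_mem (one_lt_ncard_iff_nontrivial_and_finite.1 hC₁).1 he⟩
  obtain ⟨e, heC, he⟩ := hnl hC hC₁
  obtain ⟨f, hfD, hf⟩ := hnl hD hD₁
  obtain ⟨Z, hZ, heZ, hfZ⟩ := hM he hf (hdj.ne_of_mem heC hfD)
  exact exists_isTightLink_of_inter_nonempty hZ ⟨e, heZ, heC⟩ ⟨f, hfZ, hfD⟩

lemma ncard_lt_of_disjoint [M.Finitary] (hM : IsNonseparable M) (hC : M.IsCircuit C)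
    (hmax : ∀ Z, M.IsCircuit Z → Z.ncard ≤ C.ncard) (hC₁ : 1 < C.ncard) (hD : M.IsCircuit D)
    (hdj : Disjoint C D)
    (hskew : ∀ Z, M.IsCircuit Z → (Z ∩ C).Nonempty → (Z ∩ D).Nonempty →
      (Z \ (C ∪ D)).Nonempty) :
    D.ncard < C.ncard := by
  obtain hD₁ | hD₁ := le_or_gt D.ncard 1
  · exact hD₁.trans_lt hC₁
  obtain ⟨Z, hZ⟩ := hM.exists_isTightLink hC hD hC₁ hD₁ hdj
  have outside : ∀ {Z}, IsTightLink M C D Z → (Z \ (C ∪ D)).Nonempty := fun hZ ↦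
    hskew _ hZ.isCircuit hZ.inter_left_nonempty hZ.inter_right_nonempty
  obtain ⟨W, hW, -, hWC⟩ := hZ.exists_sdiff_eq_and_ncard_le hC hdj (outside hZ)
  obtain ⟨V, hV, hVW, hVD⟩ := hW.symm.exists_sdiff_eq_and_ncard_le hD hdj.symm
    (union_comm D C ▸ outside hW)
  have hVC : V ∩ C = W ∩ C := by
    have h : ∀ {U : Set α}, U ∩ C = (U \ D) ∩ C := fun {U} ↦ by
      rw [← inter_sdiff_right_comm, (hdj.mono_left inter_subset_right).sdiff_eq_left]
    rw [h, hVW, ← h]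
  have hVfin := hV.isCircuit.finite
  have hsplit := ncard_inter_add_ncard_sdiff_eq_ncard V (C ∪ D) hVfin
  rw [inter_union_distrib_left, ncard_union_eq (hdj.mono inter_subset_right inter_subset_right)
    (hVfin.subset inter_subset_left) (hVfin.subset inter_subset_left), hVC] at hsplit
  have hpos := (outside hV.symm).ncard_pos hVfin.sdiff
  have := hmax V hV.isCircuit
  omega

lemma ncard_lt_of_isCircuit_contract [M.Finitary] (hM : IsNonseparable M) (hC : M.IsCircuit C)
    (hmax : ∀ Z, M.IsCircuit Z → Z.ncard ≤ C.ncard) (hC₁ : 1 < C.ncard)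
    (hD : (M ／ C).IsCircuit D) : D.ncard < C.ncard := by
  have hdj : Disjoint C D := (subset_sdiff.1 hD.subset_ground).2.symm
  obtain ⟨Z, hZ, hDZ, hZDC⟩ := hD.exists_subset_isCircuit_of_contract
  obtain rfl | hne := eq_or_ne D Z
  · refine hM.ncard_lt_of_disjoint hC hmax hC₁ hZ hdj fun W hW ⟨x, hxW, hxC⟩ ⟨y, hyW, hyD⟩ ↦ ?_
    by_contra! hWCD
    have hWss : W \ C ⊆ D := sdiff_subset_iff.2 (sdiff_eq_empty.1 hWCD)
    have hdep : (M ／ C).Dep (W \ C) := hW.contract_dep_of_not_subset fun h ↦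
      hdj.notMem_of_mem_right hyD (h hyW)
    have hDW : W \ C = D := hD.eq_of_dep_subset hdep hWss
    have hDW' : D = W := hZ.eq_of_subset_isCircuit hW (hDW.ge.trans sdiff_subset)
    exact hdj.notMem_of_mem_left hxC (hDW' ▸ hxW)
  · exact (ncard_lt_ncard (hDZ.ssubset_of_ne hne) hZ.finite).trans_le (hmax Z hZ)

lemma ncard_lt_of_isCircuit_contract_sdiff_singleton [M.Finitary] (hM : IsNonseparable M)
    (hC : M.IsCircuit C) (hmax : ∀ Z, M.IsCircuit Z → Z.ncard ≤ C.ncard) (hC₁ : 1 < C.ncard)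
    (he : e ∈ C) (hD : (M ／ (C \ {e})).IsCircuit D) : D.ncard < C.ncard := by
  have hloop : (M ／ (C \ {e})).IsLoop e := by
    simpa using hC.mem_closure_sdiff_singleton_of_mem he
  by_cases heD : e ∈ D
  · rw [← hloop.isCircuit.eq_of_subset_isCircuit hD (singleton_subset_iff.2 heD)]
    simpa using hC₁
  refine hM.ncard_lt_of_isCircuit_contract hC hmax hC₁ ?_
  rw [← sdiff_union_of_subset (singleton_subset_iff.2 he), ← contract_contract,
    contract_eq_delete_of_subset_loops (singleton_subset_iff.2 hloop)]
  exact delete_isCircuit_iff.2 ⟨hD, by simpa using heD⟩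

end IsNonseparable

end Circuits

/-! ### Decompositions given by words -/

section

open Matroid Set

lemma eRk_le_eRk_contract_add_encard {α : Type*} {M : Matroid α} {I X : Set α}
    (hI : M.Indep I) (hX : X ⊆ M.E) :
    M.eRk X ≤ (M ／ I).eRk (X \ I) + I.encard := by
  obtain ⟨J, hJ⟩ := (M ／ I).exists_isBasis (X \ I) (sdiff_subset_sdiff_left hX)
  calc M.eRk X ≤ M.eRk (X \ I ∪ I) := M.eRk_mono (by simp)
    _ = (J ∪ I).encard := (hI.union_isBasis_union_of_contract_isBasis hJ).encard_eq_eRk.symm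
    _ ≤ J.encard + I.encard := encard_union_le J I
    _ = (M ／ I).eRk (X \ I) + I.encard := by rw [hJ.encard_eq_eRk]

lemma append_singleton_prefix_singleton {α : Type*} {l : List α} {a b : α} :
    l ++ [b] <+: [a] ↔ l = [] ∧ b = a := by
  cases l <;> simp

end

/-- A depth-decomposition of `M`, of depth at most `d`, whose tree is encoded by words over a base:
the vertices other than the root are the elements of `base`, the word of a vertex lists the vertices
on the path from the root to it (without the root), and an element of `M` is mapped to the vertex
with the same word. The edges are identified with their lower endpoints. -/
structure WordDecomposition {α : Type*} (M : Matroid α) (d : ℕ) where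
  /-- The set of vertices other than the root. -/
  base : Set α
  /-- The path from the root to the vertex to which an element is mapped. -/
  word : α → List α
  isBase : M.IsBase base
  mem_word_self : ∀ b ∈ base, b ∈ word b
  word_eq_of_prefix : ∀ e ∈ M.E, ∀ l b, l ++ [b] <+: word e → b ∈ base ∧ word b = l ++ [b]
  length_word_le : ∀ e ∈ M.E, (word e).length ≤ d
  eRk_le : ∀ X ⊆ M.E, M.eRk X ≤ {b | ∃ e ∈ X, b ∈ word e}.encard

namespace WordDecomposition

open Matroid Set

variable {α : Type*} {M : Matroid α} {I K : Set α} {c d : ℕ} {b e : α}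

lemma mem_base_of_mem_word (D : WordDecomposition M d) (he : e ∈ M.E) (hb : b ∈ D.word e) :
    b ∈ D.base := by
  obtain ⟨l, l', h⟩ := List.append_of_mem hb
  exact (D.word_eq_of_prefix e he l b ⟨l', by simp [h]⟩).1

lemma exists_word_eq_append (D : WordDecomposition M d) (hb : b ∈ D.base) :
    ∃ l, D.word b = l ++ [b] := by
  obtain ⟨l, l', h⟩ := List.append_of_mem (D.mem_word_self b hb)
  exact ⟨l, (D.word_eq_of_prefix b (D.isBase.subset_ground hb) l b ⟨l', by simp [h]⟩).2⟩

/-- Relax the bound on the depth. -/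
def mono (D : WordDecomposition M c) (h : c ≤ d) : WordDecomposition M d :=
  { D with length_word_le := fun e he ↦ (D.length_word_le e he).trans h }

lemma nonempty_of_forall_isCircuit_subsingleton (hM : ∀ C, M.IsCircuit C → C.Subsingleton) :
    Nonempty (WordDecomposition M 1) := by
  classical
  obtain ⟨B, hB⟩ := M.exists_isBase
  have hloops : ∀ e ∈ M.E \ B, M.IsLoop e := fun e he ↦ by
    have hC := hB.fundCircuit_isCircuit he.1 he.2
    rw [← singleton_isCircuit, ← (hM _ hC).eq_singleton_of_mem (M.mem_fundCircuit e B)]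
    exact hC
  exact ⟨{
    base := B
    word := fun e ↦ if e ∈ B then [e] else []
    isBase := hB
    mem_word_self := fun b hb ↦ by simp [hb]
    word_eq_of_prefix := fun e _ l b h ↦ by
      split_ifs at h with he
      · obtain ⟨rfl, rfl⟩ := append_singleton_prefix_singleton.1 h
        simp [he]
      · simp at h
    length_word_le := fun e _ ↦ by split_ifs <;> simp
    eRk_le := fun X hX ↦ by
      have hXB : M.eRk (X \ B) = 0 :=
        (eRk_eq_zero_iff (sdiff_subset.trans hX)).2 fun e he ↦
          hloops e (sdiff_subset_sdiff_left hX he)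
      calc M.eRk X ≤ M.eRk (X ∩ B) + M.eRk (X \ B) := M.eRk_le_eRk_inter_add_eRk_sdiff X B
        _ ≤ (X ∩ B).encard := by rw [hXB, add_zero]; exact M.eRk_le_encard _
        _ ≤ {b | ∃ e ∈ X, b ∈ if e ∈ B then [e] else []}.encard :=
          encard_le_encard fun e he ↦ ⟨e, he.1, by simp [he.2]⟩ }⟩

open Classical in
/-- Glue the decompositions of the two sides of a separator at their roots. -/
noncomputable def ofSeparator (hK : IsSeparator M K) (D₁ : WordDecomposition (M ↾ K) d)
    (D₂ : WordDecomposition (M ↾ (M.E \ K)) d) : WordDecomposition M d :=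
  have h₁ : M.IsBasis D₁.base K := (isBase_restrict_iff hK.subset_ground).1 D₁.isBase
  have h₂ : M.IsBasis D₂.base (M.E \ K) := (isBase_restrict_iff sdiff_subset).1 D₂.isBase
  { base := D₁.base ∪ D₂.base
    word := fun e ↦ if e ∈ K then D₁.word e else D₂.word e
    isBase := hK.isBase_union h₁ h₂
    mem_word_self := by
      rintro b (hb | hb)
      · simpa [h₁.subset hb] using D₁.mem_word_self b hb
      · simpa [(h₂.subset hb).2] using D₂.mem_word_self b hb
    word_eq_of_prefix := fun e he l b h ↦ by
      split_ifs at h with heK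
      · obtain ⟨hb, hword⟩ := D₁.word_eq_of_prefix e heK l b h
        exact ⟨.inl hb, by simp [h₁.subset hb, hword]⟩
      · obtain ⟨hb, hword⟩ := D₂.word_eq_of_prefix e ⟨he, heK⟩ l b h
        exact ⟨.inr hb, by simp [(h₂.subset hb).2, hword]⟩
    length_word_le := fun e he ↦ by
      split_ifs with heK
      · exact D₁.length_word_le e heK
      · exact D₂.length_word_le e ⟨he, heK⟩
    eRk_le := fun X hX ↦ by
      have hXK : X \ K ⊆ M.E \ K := sdiff_subset_sdiff_left hX
      have hle₁ := D₁.eRk_le (X ∩ K) inter_subset_right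
      have hle₂ := D₂.eRk_le (X \ K) hXK
      rw [restrict_eRk_eq _ inter_subset_right] at hle₁
      rw [restrict_eRk_eq _ hXK] at hle₂
      refine (M.eRk_le_eRk_inter_add_eRk_sdiff X K).trans ((add_le_add hle₁ hle₂).trans ?_)
      rw [← encard_union_eq]
      · refine encard_le_encard ?_
        rintro b (⟨e, he, hb⟩ | ⟨e, he, hb⟩)
        · exact ⟨e, he.1, by simpa [he.2] using hb⟩
        · exact ⟨e, he.1, by simpa [he.2] using hb⟩
      · rw [disjoint_left]
        rintro b ⟨e, he, hb⟩ ⟨f, hf, hb'⟩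
        exact (h₂.subset (D₂.mem_base_of_mem_word (hXK hf) hb')).2
          (h₁.subset (D₁.mem_base_of_mem_word he.2 hb)) }

lemma prefix_cons_word {a : α} {l : List α} (D : WordDecomposition (M ／ {a}) d)
    (he : e ∈ M.E \ {a}) (h : l ++ [b] <+: a :: D.word e) :
    l = [] ∧ b = a ∨ b ∈ D.base ∧ l ++ [b] = a :: D.word b := by
  obtain - | ⟨x, l⟩ := l
  · exact .inl (by simpa using h)
  · rw [List.cons_append, List.cons_prefix_cons] at h
    obtain ⟨hb, hword⟩ := D.word_eq_of_prefix e he l b h.2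
    exact .inr ⟨hb, by rw [hword, h.1, List.cons_append]⟩

lemma eRk_le_encard_insert (he : M.IsNonloop e) (D : WordDecomposition (M ／ {e}) d) {X : Set α}
    (hX : X ⊆ M.E) : M.eRk X ≤ (insert e {b | ∃ x ∈ X \ {e}, b ∈ D.word x}).encard := by
  have hXe : X \ {e} ⊆ (M ／ {e}).E := sdiff_subset_sdiff_left hX
  rw [encard_insert_of_notMem]
  · calc M.eRk X ≤ (M ／ {e}).eRk (X \ {e}) + ({e} : Set α).encard :=
          eRk_le_eRk_contract_add_encard he.indep hX
      _ ≤ _ := by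
        rw [encard_singleton]
        gcongr
        exact D.eRk_le _ hXe
  · rintro ⟨x, hx, h⟩
    exact (D.isBase.subset_ground (D.mem_base_of_mem_word (hXe hx) h)).2 rfl

open Classical in
/-- Insert a new vertex `e` between the root and its children. -/
noncomputable def ofContractElem (he : M.IsNonloop e) (D : WordDecomposition (M ／ {e}) d) :
    WordDecomposition M (d + 1) :=
  have hbase : M.IsBase (insert e D.base) := by
    simpa using (he.indep.contract_isBase_iff.1 D.isBase).1
  have hne : ∀ {b}, b ∈ D.base → b ≠ e := fun hb ↦ (D.isBase.subset_ground hb).2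
  { base := insert e D.base
    word := fun x ↦ if x = e then [e] else e :: D.word x
    isBase := hbase
    mem_word_self := fun b hb ↦ by
      obtain rfl | hb := hb
      · simp
      · simp [hne hb, D.mem_word_self b hb]
    word_eq_of_prefix := fun x hx l b h ↦ by
      have hroot : l = [] ∧ b = e ∨ b ∈ D.base ∧ l ++ [b] = e :: D.word b := by
        split_ifs at h with hxe
        · exact .inl (append_singleton_prefix_singleton.1 h)
        · exact D.prefix_cons_word ⟨hx, hxe⟩ h
      obtain ⟨rfl, rfl⟩ | ⟨hb, hword⟩ := hroot
      · simp
      · exact ⟨.inr hb, by rw [if_neg (hne hb), hword]⟩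
    length_word_le := fun x hx ↦ by
      split_ifs with hxe
      · simp
      · simpa using D.length_word_le x ⟨hx, hxe⟩
    eRk_le := fun X hX ↦ by
      obtain rfl | ⟨x, hx⟩ := X.eq_empty_or_nonempty
      · simp
      refine (eRk_le_encard_insert he D hX).trans
        (encard_le_encard (insert_subset ⟨x, hx, by split_ifs <;> simp⟩ ?_))
      rintro b ⟨y, hy, hb⟩
      exact ⟨y, hy.1, by simp [show y ≠ e from hy.2, hb]⟩ }

lemma nonempty_of_contract_indep (hfin : I.Finite) (hI : M.Indep I)
    (h : Nonempty (WordDecomposition (M ／ I) d)) :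
    Nonempty (WordDecomposition M (d + I.ncard)) := by
  induction I, hfin using Set.Finite.induction_on generalizing d with
  | empty => simpa using h
  | @insert a s ha hs ih =>
    have hs' : M.Indep s := hI.subset (subset_insert a s)
    have hna : (M ／ s).IsNonloop a := by
      rw [← indep_singleton, hs'.contract_indep_iff, singleton_union]
      exact ⟨by simpa using ha, hI⟩
    rw [← union_singleton, ← contract_contract] at h
    rw [ncard_insert_of_notMem ha hs, add_comm _ 1, ← add_assoc]
    exact ih hs' (h.map (ofContractElem hna))

lemma nonempty_of_isNonseparable [M.Finitary] (hM : IsNonseparable M) {C : Set α}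
    (hC : M.IsCircuit C) (hmax : ∀ Z, M.IsCircuit Z → Z.ncard ≤ C.ncard) (hC₁ : 1 < C.ncard)
    (h : ∀ I, (∀ D, (M ／ I).IsCircuit D → D.ncard < C.ncard) →
      Nonempty (WordDecomposition (M ／ I) d)) :
    Nonempty (WordDecomposition M (d + (C.ncard - 1))) := by
  obtain ⟨e, he⟩ := hC.nonempty
  rw [← ncard_sdiff_singleton_of_mem he]
  exact nonempty_of_contract_indep hC.finite.sdiff (hC.sdiff_singleton_indep he) <| h _ fun _ hD ↦
    hM.ncard_lt_of_isCircuit_contract_sdiff_singleton hC hmax hC₁ he hD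

theorem nonempty_of_forall_isCircuit_ncard_le (M : Matroid α) [M.RankFinite] (hc : 1 ≤ c)
    (hM : ∀ C, M.IsCircuit C → C.ncard ≤ c) : Nonempty (WordDecomposition M (c ^ 2)) := by
  induction c, hc using Nat.le_induction generalizing M with
  | base =>
    exact nonempty_of_forall_isCircuit_subsingleton fun C hC _ hx _ hy ↦
      (ncard_le_one_iff hC.finite).1 (hM C hC) hx hy
  | succ c hc ihc =>
  induction hr : M.eRank using WellFoundedLT.induction generalizing M with
  | _ r ihr =>
  by_cases hcard : ∀ C, M.IsCircuit C → C.ncard ≤ c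
  · exact (ihc M hcard).map (mono · (by gcongr; omega))
  by_cases hsep : IsNonseparable M
  · push Not at hcard
    obtain ⟨C, hC, hlt⟩ := hcard
    have hCc : C.ncard = c + 1 := (hM C hC).antisymm hlt
    have h := nonempty_of_isNonseparable hsep hC (hCc ▸ hM) (by omega) fun I hI ↦
      ihc (M ／ I) fun D hD ↦ Nat.le_of_lt_add_one (hCc ▸ hI D hD)
    rw [hCc, Nat.add_sub_cancel] at h
    exact h.map (mono · (by nlinarith))
  · obtain ⟨K, hK, ⟨e, heK, he⟩, f, hfK, hf⟩ := exists_isSeparator_of_not_isNonseparable hsep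
    have side : ∀ {R x}, IsSeparator M R → M.IsNonloop x → x ∉ R →
        Nonempty (WordDecomposition (M ↾ R) ((c + 1) ^ 2)) := fun {R x} hR hx hxR ↦ by
      refine ihr _ ?_ (M ↾ R)
        (fun C hC ↦ hM C ((restrict_isCircuit_iff hR.subset_ground).1 hC).1) rfl
      rw [eRank_restrict, ← hr]
      exact hR.eRk_lt_eRank hx hxR
    obtain ⟨D₁⟩ := side hK hf hfK
    obtain ⟨D₂⟩ := side hK.compl he fun h ↦ h.2 heK
    exact ⟨ofSeparator hK D₁ D₂⟩

end WordDecomposition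

/-! ### Depth-decompositions bound circuits -/

section Trie

variable {α β : Type*} {w : α → List β} {Y Y₁ Y₂ S : Finset α} {l l' : List β} {b : β} {e f : α}
  {d : ℕ}

open Classical in
/-- The nonempty prefixes of the words `w e` for `e ∈ Y`. They stand for the edges of the trie of
these words: when `w e` lists the edges on the path from the root of a tree to a vertex `f e`, this
trie is the union of these paths. -/
noncomputable def trie (w : α → List β) (Y : Finset α) : Finset (List β) :=
  Y.biUnion fun e ↦ (w e).inits.toFinset.erase []

lemma mem_trie : l ∈ trie w Y ↔ l ≠ [] ∧ ∃ e ∈ Y, l <+: w e := by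
  simp only [trie, Finset.mem_biUnion, Finset.mem_erase, List.mem_toFinset, List.mem_inits]
  tauto

lemma trie_mono (h : Y₁ ⊆ Y₂) : trie w Y₁ ⊆ trie w Y₂ := by
  intro l hl
  obtain ⟨hne, e, he, hp⟩ := mem_trie.1 hl
  exact mem_trie.2 ⟨hne, e, h he, hp⟩

/-- The number of elements of `Y` minus the number of edges of their trie. The rank condition of a
depth-decomposition makes it nonpositive on independent sets. -/
noncomputable def trieExcess (w : α → List β) (Y : Finset α) : ℤ :=
  Y.card - (trie w Y).card

@[simp] lemma trieExcess_empty : trieExcess w ∅ = 0 := by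
  simp [trieExcess, trie]

lemma trieExcess_le_erase_add_one [DecidableEq α] (w : α → List β) (Y : Finset α) (x : α) :
    trieExcess w Y ≤ trieExcess w (Y.erase x) + 1 := by
  have htrie := Finset.card_le_card (trie_mono (w := w) (Y.erase_subset x))
  have hcard := Finset.pred_card_le_card_erase (s := Y) (a := x)
  rw [trieExcess, trieExcess]
  omega

lemma head?_eq_of_prefix (hl : l ≠ []) (h : l <+: l') : l'.head? = l.head? := by
  obtain ⟨t, rfl⟩ := h
  exact List.head?_append_of_ne_nil l hl

lemma trieExcess_union [DecidableEq α]
    (h : ∀ e₁ ∈ Y₁, ∀ e₂ ∈ Y₂, (w e₁).head? ≠ (w e₂).head?) :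
    trieExcess w (Y₁ ∪ Y₂) = trieExcess w Y₁ + trieExcess w Y₂ := by
  classical
  have hY : Disjoint Y₁ Y₂ := Finset.disjoint_left.2 fun e he he' ↦ h e he e he' rfl
  have htrie : Disjoint (trie w Y₁) (trie w Y₂) := by
    refine Finset.disjoint_left.2 fun l hl hl' ↦ ?_
    obtain ⟨hne, e₁, he₁, hp₁⟩ := mem_trie.1 hl
    obtain ⟨-, e₂, he₂, hp₂⟩ := mem_trie.1 hl'
    exact h e₁ he₁ e₂ he₂ (by rw [head?_eq_of_prefix hne hp₁, head?_eq_of_prefix hne hp₂])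
  have hunion : trie w (Y₁ ∪ Y₂) = trie w Y₁ ∪ trie w Y₂ := Finset.union_biUnion
  rw [trieExcess, trieExcess, trieExcess, hunion, Finset.card_union_of_disjoint hY,
    Finset.card_union_of_disjoint htrie]
  push_cast
  ring

lemma trieExcess_eq_card_of_nil (h : ∀ e ∈ Y, w e = []) : trieExcess w Y = Y.card := by
  have htrie : trie w Y = ∅ := by
    refine Finset.eq_empty_of_forall_notMem fun l hl ↦ ?_
    obtain ⟨hne, e, he, hp⟩ := mem_trie.1 hl
    exact hne (List.prefix_nil.1 (h e he ▸ hp))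
  simp [trieExcess, htrie]

lemma trieExcess_tail (h : ∀ e ∈ Y, (w e).head? = some b) (hY : Y.Nonempty) :
    trieExcess (fun e ↦ (w e).tail) Y = trieExcess w Y + 1 := by
  classical
  have hw : ∀ e ∈ Y, w e = b :: (w e).tail := fun e he ↦ List.eq_cons_of_mem_head? (h e he)
  have htrie : trie w Y = insert [b] ((trie (fun e ↦ (w e).tail) Y).image (List.cons b)) := by
    ext l
    simp only [Finset.mem_insert, Finset.mem_image, mem_trie]
    constructor
    · rintro ⟨hne, e, he, hp⟩
      rw [hw e he] at hp
      obtain ⟨l, rfl, hl⟩ := (List.prefix_cons_iff.1 hp).resolve_left hne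
      obtain rfl | hne' := eq_or_ne l []
      · exact .inl rfl
      · exact .inr ⟨l, ⟨hne', e, he, hl⟩, rfl⟩
    · rintro (rfl | ⟨l, ⟨-, e, he, hp⟩, rfl⟩)
      · obtain ⟨e, he⟩ := hY
        exact ⟨by simp, e, he, by rw [hw e he]; simp⟩
      · exact ⟨by simp, e, he, by rw [hw e he]; exact List.cons_prefix_cons.2 ⟨rfl, hp⟩⟩
  rw [trieExcess, trieExcess, htrie, Finset.card_insert_of_notMem (by simp [mem_trie]),
    Finset.card_image_of_injective _ List.cons_injective]
  push_cast
  ring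

/-- Every proper subset of `S` has smaller excess. The property passes to the part of `S` below a
child of the root of the trie, which allows induction on the depth of the trie. -/
def IsExcessCritical (w : α → List β) (S : Finset α) : Prop :=
  ∀ ⦃Y⦄, Y ⊂ S → trieExcess w Y < trieExcess w S

lemma exists_isExcessCritical_subset (hY : 0 < trieExcess w Y) :
    ∃ S ⊆ Y, IsExcessCritical w S ∧ 0 < trieExcess w S := by
  obtain ⟨S, hSY, hS⟩ := exists_minimal_le_of_wellFoundedLT (fun S ↦ 0 < trieExcess w S) Y hY
  exact ⟨S, hSY, fun Z hZ ↦ (not_lt.1 (hS.not_prop_of_lt hZ)).trans_lt hS.prop, hS.prop⟩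

namespace IsExcessCritical

lemma trieExcess_pos (hS : IsExcessCritical w S) (hne : S.Nonempty) : 0 < trieExcess w S := by
  simpa using hS hne.empty_ssubset

lemma left_of_union [DecidableEq α] (hS : IsExcessCritical w (Y₁ ∪ Y₂))
    (h : ∀ e₁ ∈ Y₁, ∀ e₂ ∈ Y₂, (w e₁).head? ≠ (w e₂).head?) : IsExcessCritical w Y₁ := by
  intro Y hY
  obtain ⟨e, he₁, heY⟩ := Finset.exists_of_ssubset hY
  have hss : Y ∪ Y₂ ⊂ Y₁ ∪ Y₂ := by
    refine ⟨Finset.union_subset_union_left hY.subset, fun hle ↦ ?_⟩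
    have he : e ∈ Y ∪ Y₂ := hle (Finset.mem_union_left _ he₁)
    exact h e he₁ e ((Finset.mem_union.1 he).resolve_left heY) rfl
  have hlt := hS hss
  rw [trieExcess_union h, trieExcess_union fun e₁ he₁ ↦ h e₁ (hY.subset he₁)] at hlt
  omega

lemma exists_ssubset_of_head?_ne (hS : IsExcessCritical w S) (he : e ∈ S) (hf : f ∈ S)
    (hfe : (w f).head? ≠ (w e).head?) :
    ∃ S₁ S₂, S₁ ⊂ S ∧ S₂ ⊂ S ∧ IsExcessCritical w S₁ ∧ IsExcessCritical w S₂ ∧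
      S.card ≤ S₁.card + S₂.card ∧ trieExcess w S₁ + trieExcess w S₂ = trieExcess w S := by
  classical
  set S₁ : Finset α := {x ∈ S | (w x).head? = (w e).head?}
  set S₂ : Finset α := {x ∈ S | (w x).head? ≠ (w e).head?}
  have hunion : S₁ ∪ S₂ = S := Finset.filter_union_filter_not_eq _ S
  have hheads : ∀ x ∈ S₁, ∀ y ∈ S₂, (w x).head? ≠ (w y).head? := fun x hx y hy h ↦
    (Finset.mem_filter.1 hy).2 (h ▸ (Finset.mem_filter.1 hx).2)
  rw [← hunion] at hS
  have hS₂ : IsExcessCritical w S₂ :=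
    (Finset.union_comm S₁ S₂ ▸ hS).left_of_union fun y hy x hx ↦ (hheads x hx y hy).symm
  exact ⟨S₁, S₂, Finset.filter_ssubset.2 ⟨f, hf, hfe⟩,
    Finset.filter_ssubset.2 ⟨e, he, not_not.2 rfl⟩, hS.left_of_union hheads, hS₂,
    hunion ▸ Finset.card_union_le S₁ S₂, by rw [← trieExcess_union hheads, hunion]⟩

lemma tail (hS : IsExcessCritical w S) (h : ∀ e ∈ S, (w e).head? = some b) :
    IsExcessCritical (fun e ↦ (w e).tail) S := by
  intro Y hY
  have hlt := hS hY
  obtain ⟨e, he, -⟩ := Finset.exists_of_ssubset hY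
  rw [trieExcess_tail h ⟨e, he⟩]
  obtain rfl | hne := Y.eq_empty_or_nonempty
  · rw [trieExcess_empty] at hlt ⊢
    omega
  · rw [trieExcess_tail (fun e he ↦ h e (hY.subset he)) hne]
    omega

lemma trieExcess_tail_le_two_mul (hS : IsExcessCritical w S)
    (h : ∀ e ∈ S, (w e).head? = some b) (hne : S.Nonempty) :
    trieExcess (fun e ↦ (w e).tail) S ≤ 2 * trieExcess w S := by
  have hpos := hS.trieExcess_pos hne
  rw [trieExcess_tail h hne]
  omega

theorem card_le_two_pow_mul (hS : IsExcessCritical w S) (hd : ∀ e ∈ S, (w e).length ≤ d) :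
    (S.card : ℤ) ≤ 2 ^ d * trieExcess w S := by
  classical
  induction d generalizing w S with
  | zero => simp [trieExcess_eq_card_of_nil fun e he ↦ by simpa using hd e he]
  | succ d ihd =>
  induction S using Finset.strongInduction with
  | H S ihS =>
  obtain rfl | ⟨e, he⟩ := S.eq_empty_or_nonempty
  · simp
  by_cases hhead : ∀ x ∈ S, (w x).head? = (w e).head?
  · obtain hnil | ⟨b, hb⟩ := Option.eq_none_or_eq_some (w e).head?
    · rw [trieExcess_eq_card_of_nil fun x hx ↦ List.head?_eq_none_iff.1 ((hhead x hx).trans hnil)]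
      exact le_mul_of_one_le_left (by positivity) (one_le_pow₀ (by norm_num))
    · have hheads : ∀ x ∈ S, (w x).head? = some b := fun x hx ↦ (hhead x hx).trans hb
      have htail := ihd (hS.tail hheads) fun x hx ↦ by
        rw [List.length_tail]
        exact Nat.sub_le_of_le_add (hd x hx)
      calc (S.card : ℤ) ≤ 2 ^ d * trieExcess (fun x ↦ (w x).tail) S := htail
        _ ≤ 2 ^ d * (2 * trieExcess w S) := by
          gcongr
          exact hS.trieExcess_tail_le_two_mul hheads ⟨e, he⟩
        _ = 2 ^ (d + 1) * trieExcess w S := by ring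
  · push Not at hhead
    obtain ⟨f, hf, hfe⟩ := hhead
    obtain ⟨S₁, S₂, hlt₁, hlt₂, hS₁, hS₂, hcard, hsum⟩ := hS.exists_ssubset_of_head?_ne he hf hfe
    have h₁ := ihS S₁ hlt₁ hS₁ fun x hx ↦ hd x (hlt₁.subset hx)
    have h₂ := ihS S₂ hlt₂ hS₂ fun x hx ↦ hd x (hlt₂.subset hx)
    calc (S.card : ℤ) ≤ S₁.card + S₂.card := by exact_mod_cast hcard
      _ ≤ 2 ^ (d + 1) * (trieExcess w S₁ + trieExcess w S₂) := by rw [mul_add]; gcongr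
      _ = 2 ^ (d + 1) * trieExcess w S := by rw [hsum]

end IsExcessCritical

end Trie

namespace FinRootedTree

variable {α : Type*} (T : FinRootedTree) {v : T.V}

lemma exists_isPath_length_eq_dist (v : T.V) :
    ∃ p : T.graph.Walk T.root v, p.IsPath ∧ p.length = T.graph.dist T.root v :=
  (T.isTree.connected.preconnected T.root v).exists_path_of_dist

/-- The path from the root to `v`. -/
noncomputable def rootPath (v : T.V) : T.graph.Walk T.root v :=
  (T.exists_isPath_length_eq_dist v).choose

lemma rootPath_isPath (v : T.V) : (T.rootPath v).IsPath :=
  (T.exists_isPath_length_eq_dist v).choose_spec.1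

lemma length_rootPath (v : T.V) : (T.rootPath v).length = T.graph.dist T.root v :=
  (T.exists_isPath_length_eq_dist v).choose_spec.2

variable {T} in
lemma eq_rootPath {p : T.graph.Walk T.root v} (hp : p.IsPath) : p = T.rootPath v :=
  (T.isTree.existsUnique_path T.root v).unique hp (T.rootPath_isPath v)

lemma dist_root_le_depth (v : T.V) : T.graph.dist T.root v ≤ T.depth := by
  have := T.finite
  have : Nonempty T.V := ⟨T.root⟩
  obtain ⟨m, hm⟩ := Finite.exists_max (T.graph.dist T.root)
  have hleaf : T.IsLeaf m := fun u hu ↦ by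
    have := hm u
    rw [hu.2] at this
    omega
  have hbdd : T.graph.dist T.root m ∈ upperBounds
      {n | ∃ v, T.IsLeaf v ∧ ∃ p : T.graph.Walk T.root v, p.IsPath ∧ p.length = n} := by
    rintro n ⟨u, -, p, hp, rfl⟩
    rw [eq_rootPath hp, length_rootPath]
    exact hm u
  exact (hm v).trans (le_csSup ⟨_, hbdd⟩ ⟨m, hleaf, T.rootPath m, T.rootPath_isPath m,
    T.length_rootPath m⟩)

/-- The sequence of edges on the path from the root to `v`; the trie of these words is a copy of
the union of the paths. -/
noncomputable def edgeWord (v : T.V) : List (Sym2 T.V) :=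
  (T.rootPath v).edges

lemma length_edgeWord_le_depth (v : T.V) : (T.edgeWord v).length ≤ T.depth := by
  rw [edgeWord, SimpleGraph.Walk.length_edges, length_rootPath]
  exact T.dist_root_le_depth v

lemma exists_edgeWord_eq_of_mem_trie {f : α → T.V} {Y : Finset α} {l : List (Sym2 T.V)}
    (hl : l ∈ trie (T.edgeWord ∘ f) Y) : ∃ v ≠ T.root, T.edgeWord v = l := by
  obtain ⟨hne, e, -, hp⟩ := mem_trie.1 hl
  have hword : T.edgeWord ((T.rootPath (f e)).getVert l.length) = l := by
    rw [edgeWord, ← eq_rootPath ((T.rootPath_isPath (f e)).take l.length),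
      SimpleGraph.Walk.edges_take]
    exact (List.prefix_iff_eq_take.1 hp).symm
  refine ⟨_, fun hroot ↦ hne ?_, hword⟩
  rw [← hword, edgeWord, ← List.length_eq_zero_iff, SimpleGraph.Walk.length_edges,
    length_rootPath, hroot, SimpleGraph.dist_self]

lemma card_trie_le_encard_edgeSet (f : α → T.V) (Y : Finset α) :
    (trie (T.edgeWord ∘ f) Y).card ≤ T.graph.edgeSet.encard := by
  have := T.finite
  have hsub : (trie (T.edgeWord ∘ f) Y : Set (List (Sym2 T.V))) ⊆ T.edgeWord '' {T.root}ᶜ :=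
    fun l hl ↦ T.exists_edgeWord_eq_of_mem_trie hl
  have hcard : T.graph.edgeSet.ncard + 1 = Nat.card T.V :=
    (SimpleGraph.isTree_iff_connected_and_card.1 T.isTree).2
  have hcompl := Set.ncard_add_ncard_compl {T.root}
  rw [Set.ncard_singleton] at hcompl
  rw [← Set.encard_coe_eq_coe_finsetCard]
  calc _ ≤ (T.edgeWord '' {T.root}ᶜ).encard := Set.encard_le_encard hsub
    _ ≤ ({T.root}ᶜ : Set T.V).encard := Set.encard_image_le _ _
    _ = T.graph.edgeSet.encard := by
      rw [← (Set.toFinite _).cast_ncard_eq, ← (Set.toFinite T.graph.edgeSet).cast_ncard_eq]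
      congr 1
      omega

lemma encard_rootPathsEdges_le_card_trie (f : α → T.V) (Y : Finset α) :
    (T.rootPathsEdges (f '' Y)).encard ≤ (trie (T.edgeWord ∘ f) Y).card := by
  have hsub : some '' T.rootPathsEdges (f '' Y) ⊆
      List.getLast? '' (trie (T.edgeWord ∘ f) Y : Set (List (Sym2 T.V))) := by
    rintro _ ⟨a, ⟨_, ⟨e, he, rfl⟩, p, hp, ha⟩, rfl⟩
    rw [eq_rootPath hp] at ha
    obtain ⟨s, t, hst⟩ := List.append_of_mem ha
    exact ⟨s ++ [a], mem_trie.2 ⟨by simp, e, he, t, by simp [edgeWord, hst]⟩, by simp⟩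
  rw [← (Option.some_injective _).encard_image, ← Set.encard_coe_eq_coe_finsetCard]
  exact (Set.encard_le_encard hsub).trans (Set.encard_image_le _ _)

end FinRootedTree

lemma subset_of_dep_of_subset_insert {α : Type*} {M : Matroid α} {I C X : Set α} {e : α}
    (hI : M.Indep I) (hC : M.IsCircuit C) (hCI : C ⊆ insert e I) (hX : M.Dep X)
    (hXI : X ⊆ insert e I) : C ⊆ X := by
  obtain ⟨K, hKX, hK⟩ := hX.exists_isCircuit_subset
  rwa [hC.eq_fundCircuit_of_subset hI hCI, ← hK.eq_fundCircuit_of_subset hI (hKX.trans hXI)]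

namespace DepthDecomposition

variable {α : Type*} {M : Matroid α} {B C : Set α} {x : α} {Y : Finset α}

/-- The word of an element: the edges on the path from the root to its vertex. -/
noncomputable def word (D : DepthDecomposition M) (e : α) : List (Sym2 D.tree.V) :=
  D.tree.edgeWord (D.f e)

lemma trieExcess_nonpos (D : DepthDecomposition M) (hY : M.Indep Y) :
    trieExcess D.word Y ≤ 0 := by
  have hle := (D.rank_le Y hY.subset_ground).trans
    (D.tree.encard_rootPathsEdges_le_card_trie D.f Y)
  rw [hY.eRk_eq_encard, Set.encard_coe_eq_coe_finsetCard] at hle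
  exact Int.sub_nonpos_of_le (by exact_mod_cast hle)

lemma trieExcess_le_one [DecidableEq α] (D : DepthDecomposition M) (hY : M.Indep ↑(Y.erase x)) :
    trieExcess D.word Y ≤ 1 := by
  have := D.trieExcess_nonpos hY
  have := trieExcess_le_erase_add_one D.word Y x
  omega

lemma trieExcess_pos (D : DepthDecomposition M) (hY : M.eRank < Y.card) :
    0 < trieExcess D.word Y := by
  have hlt := (D.tree.card_trie_le_encard_edgeSet D.f Y).trans_lt (D.rank_eq ▸ hY)
  exact Int.sub_pos_of_lt (by exact_mod_cast hlt)

theorem ncard_isCircuit_le [M.RankFinite] (D : DepthDecomposition M) (hC : M.IsCircuit C) :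
    C.ncard ≤ 2 ^ D.tree.depth := by
  classical
  obtain ⟨x, hx⟩ := hC.nonempty
  obtain ⟨B, hB, hCB⟩ := (hC.sdiff_singleton_indep hx).exists_isBase_superset
  have hCB' : C ⊆ insert x B := Set.sdiff_singleton_subset_iff.1 hCB
  have hxB : x ∉ B := fun h ↦ hC.not_indep (hB.indep.subset (Set.insert_eq_of_mem h ▸ hCB'))
  lift B to Finset α using hB.finite
  lift C to Finset α using hC.finite
  have hpos : 0 < trieExcess D.word (insert x B) := D.trieExcess_pos <| by
    rw [← hB.encard_eq_eRank, Set.encard_coe_eq_coe_finsetCard,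
      Finset.card_insert_of_notMem (by exact_mod_cast hxB)]
    exact_mod_cast B.card.lt_succ_self
  obtain ⟨S, hSB, hS, hSpos⟩ := exists_isExcessCritical_subset hpos
  have hSB' : (S : Set α) ⊆ insert x ↑B := by exact_mod_cast hSB
  have hSE : (S : Set α) ⊆ M.E :=
    hSB'.trans (Set.insert_subset (hC.subset_ground hx) hB.subset_ground)
  have hdep : M.Dep S :=
    (Matroid.not_indep_iff hSE).1 fun h ↦ (D.trieExcess_nonpos h).not_gt hSpos
  have hCS : C ⊆ S := by
    exact_mod_cast subset_of_dep_of_subset_insert hB.indep hC hCB' hdep hSB'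
  have hle : trieExcess D.word S ≤ 1 := D.trieExcess_le_one <| hB.indep.subset <| by
    exact_mod_cast Finset.subset_insert_iff.1 hSB
  have hcard := hS.card_le_two_pow_mul fun e _ ↦ D.tree.length_edgeWord_le_depth (D.f e)
  rw [Set.ncard_coe_finset]
  zify
  calc (C.card : ℤ) ≤ S.card := by exact_mod_cast Finset.card_le_card hCS
    _ ≤ 2 ^ D.tree.depth * trieExcess D.word S := hcard
    _ ≤ 2 ^ D.tree.depth := mul_le_of_le_one_right (by positivity) hle

end DepthDecomposition

/-! ### Trees from words -/

/-- A finite rooted tree whose vertices are labelled by distinct words: the root by the empty word,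
and the parent of any other vertex by the word without its last letter. The root is its own
parent. -/
structure WordTree (β : Type*) where
  /-- The vertices; their type lives in the universe required by `FinRootedTree`. -/
  V : Type
  finite : Finite V
  /-- The label of a vertex. -/
  word : V → List β
  word_injective : Function.Injective word
  /-- The root. -/
  root : V
  word_root : word root = []
  /-- The parent of a vertex. -/
  parent : V → V
  word_parent : ∀ v, word (parent v) = (word v).dropLast

namespace WordTree

variable {β : Type*}

lemma exists_range_word_eq {P : Set (List β)} (hfin : P.Finite) (hnil : [] ∈ P)
    (hP : ∀ l ∈ P, l.dropLast ∈ P) : ∃ T : WordTree β, Set.range T.word = P := by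
  have := hfin.to_subtype
  obtain ⟨n, ⟨ι⟩⟩ := Finite.exists_equiv_fin P
  let T : WordTree β := {
    V := Fin n
    finite := inferInstance
    word := fun v ↦ ι.symm v
    word_injective := Subtype.val_injective.comp ι.symm.injective
    root := ι ⟨[], hnil⟩
    word_root := by simp
    parent := fun v ↦ ι ⟨(ι.symm v : List β).dropLast, hP _ (ι.symm v).2⟩
    word_parent := by simp }
  exact ⟨T, (ι.symm.surjective.range_comp Subtype.val).trans Subtype.range_coe⟩

variable (T : WordTree β) {u v : T.V} {d : ℕ}

variable {T} in
lemma exists_word_eq_append (hv : v ≠ T.root) : ∃ b, T.word v = T.word (T.parent v) ++ [b] := by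
  have hne : T.word v ≠ [] := fun h ↦ hv (T.word_injective (h.trans T.word_root.symm))
  exact ⟨(T.word v).getLast hne, by rw [T.word_parent, List.dropLast_append_getLast]⟩

variable {T} in
lemma length_word (hv : v ≠ T.root) :
    (T.word v).length = (T.word (T.parent v)).length + 1 := by
  obtain ⟨b, hb⟩ := exists_word_eq_append hv
  simp [hb]

/-- The graph in which every vertex other than the root is joined to its parent. -/
def graph : SimpleGraph T.V :=
  SimpleGraph.fromRel fun u v ↦ u ≠ T.root ∧ T.parent u = v

variable {T} in
lemma parent_of_adj (h : T.graph.Adj u v) :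
    (u ≠ T.root ∧ T.parent u = v) ∨ (v ≠ T.root ∧ T.parent v = u) :=
  ((SimpleGraph.fromRel_adj _ _ _).1 h).2

variable {T} in
lemma adj_parent (hv : v ≠ T.root) : T.graph.Adj (T.parent v) v := by
  refine (SimpleGraph.fromRel_adj _ _ _).2 ⟨fun h ↦ ?_, .inr ⟨hv, rfl⟩⟩
  have := length_word hv
  rw [h] at this
  omega

lemma exists_walk (v : T.V) :
    ∃ p : T.graph.Walk T.root v, p.length = (T.word v).length ∧
      ∀ u ≠ T.root, T.word u <+: T.word v → s(T.parent u, u) ∈ p.edges := by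
  induction hn : (T.word v).length generalizing v with
  | zero =>
    obtain rfl : v = T.root :=
      T.word_injective ((List.length_eq_zero_iff.1 hn).trans T.word_root.symm)
    refine ⟨.nil, rfl, fun u hu h ↦ absurd (T.word_injective ?_) hu⟩
    rw [T.word_root] at h ⊢
    exact List.prefix_nil.1 h
  | succ n ih =>
    have hv : v ≠ T.root := by
      rintro rfl
      simp [T.word_root] at hn
    obtain ⟨p, hp, hedges⟩ := ih (T.parent v) (by have := length_word hv; omega)
    refine ⟨p.concat (adj_parent hv), by simp [hp], fun u hu h ↦ ?_⟩
    rw [SimpleGraph.Walk.edges_concat, List.concat_eq_append, List.mem_append, List.mem_singleton]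
    obtain ⟨b, hb⟩ := exists_word_eq_append hv
    obtain heq | h := List.prefix_concat_iff.1 (hb ▸ h)
    · obtain rfl := T.word_injective (heq.trans hb.symm)
      exact .inr rfl
    · exact .inl (hedges u hu h)

variable {T} in
lemma length_word_le_of_walk (p : T.graph.Walk u v) :
    (T.word v).length ≤ (T.word u).length + p.length := by
  induction p with
  | nil => simp
  | cons hadj p ih =>
    rw [SimpleGraph.Walk.length_cons]
    obtain ⟨hne, rfl⟩ | ⟨hne, rfl⟩ := parent_of_adj hadj <;>
    · have := length_word hne
      omega

lemma connected : T.graph.Connected := by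
  have hroot : ∀ v, T.graph.Reachable T.root v := fun v ↦ ⟨(T.exists_walk v).choose⟩
  have : Nonempty T.V := ⟨T.root⟩
  exact ⟨fun u v ↦ (hroot u).symm.trans (hroot v)⟩

lemma dist_root (v : T.V) : T.graph.dist T.root v = (T.word v).length := by
  obtain ⟨p, hp, -⟩ := T.exists_walk v
  refine le_antisymm (hp ▸ SimpleGraph.dist_le p) ?_
  obtain ⟨q, hq⟩ := T.connected.exists_walk_length_eq_dist T.root v
  simpa [T.word_root, hq] using length_word_le_of_walk q

lemma injOn_edge : Set.InjOn (fun v ↦ s(T.parent v, v)) {v | v ≠ T.root} := by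
  intro u hu v hv huv
  obtain ⟨-, h⟩ | ⟨hu', hv'⟩ := Sym2.eq_iff.1 huv
  · exact h
  · have hlu := length_word hu
    have hlv := length_word hv
    rw [hu'] at hlu
    rw [← hv'] at hlv
    omega

lemma edgeSet_eq : T.graph.edgeSet = (fun v ↦ s(T.parent v, v)) '' {v | v ≠ T.root} := by
  ext a
  induction a with
  | _ u v =>
  constructor
  · intro h
    obtain ⟨hne, rfl⟩ | ⟨hne, rfl⟩ := parent_of_adj ((SimpleGraph.mem_edgeSet _).1 h)
    · exact ⟨u, hne, Sym2.eq_swap⟩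
    · exact ⟨v, hne, rfl⟩
  · rintro ⟨x, hx, hxe⟩
    rw [← hxe]
    exact adj_parent hx

lemma encard_edgeSet : T.graph.edgeSet.encard = {v | v ≠ T.root}.encard := by
  rw [T.edgeSet_eq, T.injOn_edge.encard_image]

lemma isTree : T.graph.IsTree := by
  have := T.finite
  refine SimpleGraph.isTree_iff_connected_and_card.2 ⟨T.connected, ?_⟩
  rw [Nat.card_coe_set_eq, T.edgeSet_eq, T.injOn_edge.ncard_image, ← Set.ncard_univ,
    ← Set.ncard_sdiff_singleton_add_one (Set.mem_univ T.root)]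
  congr 2
  ext
  simp

/-- The underlying rooted tree, without the labels. -/
def toFinRootedTree : FinRootedTree where
  V := T.V
  finite := T.finite
  graph := T.graph
  isTree := T.isTree
  root := T.root

lemma depth_toFinRootedTree_le (hd : ∀ v, (T.word v).length ≤ d) :
    T.toFinRootedTree.depth ≤ d := by
  refine csSup_le' ?_
  rintro n ⟨v, -, p, hp, rfl⟩
  rw [FinRootedTree.eq_rootPath hp, FinRootedTree.length_rootPath]
  exact (T.dist_root v).trans_le (hd v)

variable {T} in
lemma mem_rootPathsEdges {S : Set T.V} (hv : v ∈ S) (hu : u ≠ T.root)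
    (huv : T.word u <+: T.word v) : s(T.parent u, u) ∈ T.toFinRootedTree.rootPathsEdges S := by
  obtain ⟨p, hp, hedges⟩ := T.exists_walk v
  exact ⟨v, hv, p, p.isPath_of_length_eq_dist (hp.trans (T.dist_root v).symm), hedges u hu huv⟩

lemma exists_isLeaf_word_prefix (u : T.V) :
    ∃ v, T.toFinRootedTree.IsLeaf v ∧ T.word u <+: T.word v := by
  have := T.finite
  obtain ⟨v, hv, hmax⟩ := Set.exists_max_image {v | T.word u <+: T.word v}
    (fun v ↦ (T.word v).length) (Set.toFinite _) ⟨u, List.prefix_rfl⟩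
  refine ⟨v, ?_, hv⟩
  rintro (c : T.V) ⟨hadj, hdist⟩
  have hlen : (T.word c).length = (T.word v).length + 1 := by
    rw [← T.dist_root, ← T.dist_root]
    exact hdist
  obtain ⟨hne, rfl⟩ | ⟨hne, rfl⟩ := parent_of_adj hadj
  · have := length_word hne
    omega
  · obtain ⟨b, hb⟩ := exists_word_eq_append hne
    have := hmax c (hv.trans ⟨[b], hb.symm⟩)
    omega

end WordTree

namespace WordDecomposition

variable {α : Type*} {M : Matroid α} {d : ℕ} {b e : α}

lemma injOn_word (D : WordDecomposition M d) : Set.InjOn D.word D.base := by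
  intro b hb c hc h
  obtain ⟨l, hl⟩ := D.exists_word_eq_append hb
  obtain ⟨l', hl'⟩ := D.exists_word_eq_append hc
  rw [hl, hl'] at h
  exact List.singleton_inj.1 (List.append_inj_right' h rfl)

lemma word_ne_nil (D : WordDecomposition M d) (hb : b ∈ D.base) : D.word b ≠ [] :=
  List.ne_nil_of_mem (D.mem_word_self b hb)

lemma word_prefix_of_mem_word (D : WordDecomposition M d) (he : e ∈ M.E) (hb : b ∈ D.word e) :
    D.word b <+: D.word e := by
  obtain ⟨l, l', h⟩ := List.append_of_mem hb
  have hp : l ++ [b] <+: D.word e := ⟨l', by simp [h]⟩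
  rwa [(D.word_eq_of_prefix e he l b hp).2]

/-- The words of the vertices of the tree encoded by `D`; the empty word stands for the root. -/
def vertexWords (D : WordDecomposition M d) : Set (List α) :=
  insert [] (D.word '' D.base)

lemma mem_vertexWords_of_prefix (D : WordDecomposition M d) {l : List α} (he : e ∈ M.E)
    (h : l <+: D.word e) : l ∈ D.vertexWords := by
  obtain rfl | ⟨l, b, rfl⟩ := l.eq_nil_or_concat
  · exact .inl rfl
  · rw [List.concat_eq_append] at h ⊢
    obtain ⟨hb, hword⟩ := D.word_eq_of_prefix e he l b h
    exact .inr ⟨b, hb, hword⟩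

lemma exists_wordTree [M.RankFinite] (D : WordDecomposition M d) :
    ∃ T : WordTree α, Set.range T.word = D.vertexWords := by
  refine WordTree.exists_range_word_eq ((D.isBase.finite.image _).insert _) (.inl rfl) ?_
  rintro _ (rfl | ⟨b, hb, rfl⟩)
  · exact .inl rfl
  · exact D.mem_vertexWords_of_prefix (D.isBase.subset_ground hb) (List.dropLast_prefix _)

lemma exists_vertex (D : WordDecomposition M d) {T : WordTree α}
    (hT : Set.range T.word = D.vertexWords) (he : e ∈ M.E) :
    ∃ v, (e ∈ D.base → T.word v = D.word e) ∧ (e ∉ D.base → T.toFinRootedTree.IsLeaf v) ∧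
      D.word e <+: T.word v := by
  obtain ⟨u, hu⟩ : D.word e ∈ Set.range T.word :=
    hT ▸ D.mem_vertexWords_of_prefix he List.prefix_rfl
  by_cases heB : e ∈ D.base
  · exact ⟨u, fun _ ↦ hu, absurd heB, hu ▸ List.prefix_rfl⟩
  · obtain ⟨v, hv, huv⟩ := T.exists_isLeaf_word_prefix u
    exact ⟨v, fun h ↦ absurd h heB, fun _ ↦ hv, hu ▸ huv⟩

lemma bijOn_of_word_eq (D : WordDecomposition M d) {T : WordTree α}
    (hT : Set.range T.word = D.vertexWords) {f : α → T.V}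
    (hf : ∀ b ∈ D.base, T.word (f b) = D.word b) : Set.BijOn f D.base {v | v ≠ T.root} := by
  refine ⟨fun b hb h ↦ D.word_ne_nil hb ?_, fun b hb c hc h ↦ D.injOn_word hb hc ?_, fun v hv ↦ ?_⟩
  · rw [← hf b hb, h, T.word_root]
  · rw [← hf b hb, h, hf c hc]
  · obtain h | ⟨b, hb, h⟩ : T.word v ∈ D.vertexWords := hT ▸ ⟨v, rfl⟩
    · exact absurd (T.word_injective (h.trans T.word_root.symm)) hv
    · exact ⟨b, hb, T.word_injective ((hf b hb).trans h)⟩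

lemma length_word_le_of_range (D : WordDecomposition M d) {T : WordTree α}
    (hT : Set.range T.word = D.vertexWords) (v : T.V) :
    (T.word v).length ≤ d := by
  obtain h | ⟨b, hb, h⟩ : T.word v ∈ D.vertexWords := hT ▸ ⟨v, rfl⟩
  · simp [h]
  · exact h ▸ D.length_word_le b (D.isBase.subset_ground hb)

lemma eRk_le_encard_rootPathsEdges (D : WordDecomposition M d) {T : WordTree α} {f : α → T.V}
    (hbij : Set.BijOn f D.base {v | v ≠ T.root}) (hf : ∀ b ∈ D.base, T.word (f b) = D.word b)
    (hfE : ∀ e ∈ M.E, D.word e <+: T.word (f e)) {X : Set α} (hX : X ⊆ M.E) :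
    M.eRk X ≤ (T.toFinRootedTree.rootPathsEdges (f '' X)).encard := by
  have hbase : {b | ∃ e ∈ X, b ∈ D.word e} ⊆ D.base := by
    rintro b ⟨e, he, hb⟩
    exact D.mem_base_of_mem_word (hX he) hb
  have hinj : Set.InjOn (fun b ↦ s(T.parent (f b), f b)) {b | ∃ e ∈ X, b ∈ D.word e} :=
    (T.injOn_edge.comp hbij.injOn hbij.mapsTo).mono hbase
  refine (D.eRk_le X hX).trans (hinj.encard_image ▸ Set.encard_le_encard ?_)
  rintro _ ⟨b, ⟨e, he, hb⟩, rfl⟩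
  have hbB := D.mem_base_of_mem_word (hX he) hb
  refine WordTree.mem_rootPathsEdges (Set.mem_image_of_mem f he) (hbij.mapsTo hbB) ?_
  rw [hf b hbB]
  exact (D.word_prefix_of_mem_word (hX he) hb).trans (hfE e (hX he))

theorem exists_depthDecomposition [M.RankFinite] (D : WordDecomposition M d) :
    ∃ D' : DepthDecomposition M, Set.BijOn D'.f D.base {v | v ≠ D'.tree.root} ∧
      (∀ e ∈ M.E \ D.base, D'.tree.IsLeaf (D'.f e)) ∧ D'.tree.depth ≤ d := by
  obtain ⟨T, hT⟩ := D.exists_wordTree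
  have : Inhabited T.V := ⟨T.root⟩
  choose! f hfB hfleaf hfE using fun e he ↦ D.exists_vertex hT (e := e) he
  have hf : ∀ b ∈ D.base, T.word (f b) = D.word b := fun b hb ↦
    hfB b (D.isBase.subset_ground hb) hb
  have hbij := D.bijOn_of_word_eq hT hf
  have hrank : M.eRank = T.graph.edgeSet.encard := by
    rw [T.encard_edgeSet, ← D.isBase.encard_eq_eRank, ← hbij.image_eq, hbij.injOn.encard_image]
  exact ⟨⟨T.toFinRootedTree, f, hrank, fun X ↦ D.eRk_le_encard_rootPathsEdges hbij hf hfE⟩, hbij,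
    fun e he ↦ hfleaf e he.1 he.2, T.depth_toFinRootedTree_le (D.length_word_le_of_range hT)⟩

end WordDecomposition

lemma exists_depthDecomposition_of_forall_isCircuit_ncard_le {α : Type*} (M : Matroid α)
    [M.RankFinite] {c : ℕ} (hc : 1 ≤ c) (hM : ∀ C, M.IsCircuit C → C.ncard ≤ c) :
    ∃ (D : DepthDecomposition M) (B : Set α), M.IsBase B ∧
      Set.BijOn D.f B {v | v ≠ D.tree.root} ∧
      (∀ e ∈ M.E \ B, D.tree.IsLeaf (D.f e)) ∧ D.tree.depth ≤ c ^ 2 := by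
  obtain ⟨W⟩ := WordDecomposition.nonempty_of_forall_isCircuit_ncard_le M hc hM
  obtain ⟨D, hD⟩ := W.exists_depthDecomposition
  exact ⟨D, W.base, W.isBase, hD⟩

lemma ncard_isCircuit_le_ncard_isBase_add_one {α : Type*} {M : Matroid α} [M.RankFinite]
    {B C : Set α} (hB : M.IsBase B) (hC : M.IsCircuit C) : C.ncard ≤ B.ncard + 1 := by
  have hle : C.encard ≤ B.encard + 1 := by
    rw [← hC.eRk_add_one_eq, hB.encard_eq_eRank]
    gcongr
    exact M.eRk_le_eRank C
  rw [← hC.finite.cast_ncard_eq, ← hB.finite.cast_ncard_eq] at hle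
  exact_mod_cast hle

lemma exists_depth_eq_branchDepth {α : Type*} (M : Matroid α) [M.RankFinite] :
    ∃ D : DepthDecomposition M, D.tree.depth = branchDepth M := by
  obtain ⟨B, hB⟩ := M.exists_isBase
  obtain ⟨D, -⟩ := exists_depthDecomposition_of_forall_isCircuit_ncard_le M
    (Nat.le_add_left 1 _) fun C ↦ ncard_isCircuit_le_ncard_isBase_add_one hB
  have hne : {d | ∃ D : DepthDecomposition M, D.tree.depth = d}.Nonempty := ⟨_, D, rfl⟩
  exact Nat.sInf_mem hne

theorem corollaryc_general {α : Type*} (M : Matroid α) [M.RankFinite] :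
    ∃ (D : DepthDecomposition M) (B : Set α),
      M.IsBase B ∧
      Set.BijOn D.f B {v | v ≠ D.tree.root} ∧
      (∀ e ∈ M.E \ B, D.tree.IsLeaf (D.f e)) ∧
      D.tree.depth ≤ 4 ^ branchDepth M := by
  obtain ⟨D, hD⟩ := exists_depth_eq_branchDepth M
  have hpow : 4 ^ branchDepth M = (2 ^ branchDepth M) ^ 2 := by
    rw [← pow_mul, mul_comm, pow_mul]
    norm_num
  rw [hpow]
  exact exists_depthDecomposition_of_forall_isCircuit_ncard_le M Nat.one_le_two_pow
    fun C hC ↦ hD ▸ D.ncard_isCircuit_le hC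

theorem corollaryc {α : Type*} (M : Matroid α) [M.Finite] :
    ∃ (D : DepthDecomposition M) (B : Set α),
      M.IsBase B ∧
      Set.BijOn D.f B {v | v ≠ D.tree.root} ∧
      (∀ e ∈ M.E \ B, D.tree.IsLeaf (D.f e)) ∧
      D.tree.depth ≤ 4 ^ branchDepth M :=
  corollaryc_general M
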